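/- A transposition of a $*$-algebra is a $\mathbb{C}$-linear involution $a\mapsto a^{\mathrm T}$ with $(ab)^{\mathrm T}=b^{\mathrm T}a^{\mathrm T}$ and $(a^*)^{\mathrm T}=(a^{\mathrm T})^*$. A block algebra $\mathcal{S}$ is a $C^*$-algebra with a transposition which, as an algebra with involution and transposition, is isomorphic to $\mathrm{Mat}_s(\mathbb{C})$ (with transpose conjugate and transpose) for some integer $s>0$. Let $A\mapsto A^{1\otimes\mathrm T}$ be the linear map of $\mathcal{S}\otimes\mathcal{S}$ to itself with $(x\otimes y)^{1\otimes\mathrm T}=x\otimes y^{\mathrm T}$. Let $\mathcal{H}$ be the Hilbert space with orthonormal basis $v(i_1\cdots i_k)$ indexed by all finite sequences of positive integers, including the empty one, let $1_{\mathcal H}=v(\emptyset)$, let $\phi(A)=(1_{\mathcal H},A1_{\mathcal H})$ for $A\in B(\mathcal{H})$ (inner products being linear on the right), let $\Sigma_\ell\in B(\mathcal{H})$ be given by $\Sigma_\ell v(i_1\cdots i_k)=v(\ell i_1\cdots i_k)$, and put $\Xi_\ell=\mathrm{i}^\ell\Sigma_\ell+\mathrm{i}^{-\ell}\Sigma_\ell^*$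 for $\ell=1,2,\dots$. Let $\phi_{\mathcal S}:B(\mathcal{H})\otimes\mathcal{S}\to\mathcal{S}$ be the linear map with $\phi_{\mathcal S}(x\otimes y)=\phi(x)y$, and let $\phi_{\mathcal S,\mathcal S}:(B(\mathcal{H})\otimes\mathcal{S})\times(B(\mathcal{H})\otimes\mathcal{S})\to\mathcal{S}\otimes\mathcal{S}$ be the bilinear map with $\phi_{\mathcal S,\mathcal S}(x_1\otimes y_1,x_2\otimes y_2)=\phi(x_1x_2)\,y_1\otimes y_2$. An $\mathcal{S}$-linear form is an element $L=\sum_{\ell\ge1}\mathbf{X}_\ell\otimes a_\ell$ of $\mathbb{C}\langle\mathbf{X}_1,\mathbf{X}_2,\dots\rangle\otimes\mathcal{S}$ with $a_\ell\in\mathcal{S}$ vanishing for all but finitely many $\ell$; put $L(\Xi)=\sum_\ell\Xi_\ell\otimes a_\ell\in B(\mathcal{H})\otimes\mathcal{S}$. Let $\mathcal{D}_L$ be the set of $\Lambda\in\mathcal{S}$ such that $L(\Xi)-1\otimes\Lambda$ is invertible in $B(\mathcal{H})\otimes\mathcal{S}$. For $\Lambda\in\mathcal{D}_L$ put $G_L(\Lambda)=\phi_{\mathcal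 S}\big((L(\Xi)-1\otimes\Lambda)^{-1}\big)$, and for $\mathcal{S}$-linear forms $L_1,L_2$ and $\Lambda_j\in\mathcal{D}_{L_j}$ put $$G_{L_1,L_2}(\Lambda_1,\Lambda_2)=\phi_{\mathcal S,\mathcal S}\big((L_1(\Xi)-1\otimes\Lambda_1)^{-1},(L_2(\Xi)-1\otimes\Lambda_2)^{-1}\big).$$ **Proposition.** Let $\mathcal{S}$ be a block algebra. For $j=1,2$ let $L_j=\sum_\ell\mathbf{X}_\ell\otimes a_{\ell j}$ be an $\mathcal{S}$-linear form and let $\Lambda_j\in\mathcal{D}_{L_j}$. Then $G_{L_1}(\Lambda_1)$ and $G_{L_2}(\Lambda_2)$ are invertible in $\mathcal{S}$, the element $\big(G_{L_1}(\Lambda_1)^{-1}\otimes G_{L_2}(\Lambda_2)^{-1}-\sum_\ell a_{\ell1}\otimes a_{\ell2}\big)^{1\otimes\mathrm T}$ is invertible in $\mathcal{S}\otimes\mathcal{S}$, and $$G_{L_1,L_2}(\Lambda_1,\Lambda_2)=\left(\left(\Big(G_{L_1}(\Lambda_1)^{-1}\otimes G_{L_2}(\Lambda_2)^{-1}-\sum_\ell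 a_{\ell1}\otimes a_{\ell2}\Big)^{1\otimes\mathrm T}\right)^{-1}\right)^{1\otimes\mathrm T}.$$ -/

import Mathlib

open scoped TensorProduct

noncomputable section

/-! ### Boltzmann-Fock space -/

namespace BoltzmannFock

/-- Boltzmann-Fock space: the Hilbert space with orthonormal basis indexed by the finite
sequences of positive integers, including the empty one. -/
abbrev Fock : Type := lp (fun _ : List ℕ+ => ℂ) 2

/-- The basis vector `v(i₁ ⋯ iₖ)`. -/
def vec (w : List ℕ+) : Fock := lp.single 2 w (1 : ℂ)

/-- The vacuum vector `1_H = v(∅)`. -/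
def vacuum : Fock := vec []

theorem norm_vec (w : List ℕ+) : ‖vec w‖ = 1 := by
  simp [vec, lp.norm_single]

theorem orthonormal_vec : Orthonormal ℂ vec := by
  refine ⟨norm_vec, fun v w hvw => ?_⟩
  simp only [vec, lp.inner_single_left, lp.single_apply]
  rw [Pi.single_eq_of_ne hvw, inner_zero_right]

theorem orthonormal_vec_cons (i : ℕ+) : Orthonormal ℂ (fun w : List ℕ+ => vec (i :: w)) :=
  orthonormal_vec.comp (fun w : List ℕ+ => i :: w) (List.cons_injective)

/-- The (left) raising operator `Σ_i`; see `raise_vec` for its characterization. -/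
def raise (i : ℕ+) : Fock →L[ℂ] Fock :=
  (orthonormal_vec_cons i).orthogonalFamily.linearIsometry.toContinuousLinearMap

/-- `Σ_i v(i₁ ⋯ iₖ) = v(i i₁ ⋯ iₖ)`. -/
theorem raise_vec (i : ℕ+) (w : List ℕ+) : raise i (vec w) = vec (i :: w) := by
  simp only [raise, vec, LinearIsometry.coe_toContinuousLinearMap]
  rw [OrthogonalFamily.linearIsometry_apply_single]
  simp

/-- The C*-algebra `B(H)` of bounded operators on Boltzmann-Fock space. -/
def BH : Type := Fock →L[ℂ] Fock

instance : CStarAlgebra BH := inferInstanceAs (CStarAlgebra (Fock →L[ℂ] Fock))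

/-- An element of `B(H)` viewed as an operator. -/
def BH.toCLM (A : BH) : Fock →L[ℂ] Fock := A

/-- The raising operator `Σ_i` as an element of `B(H)`. -/
def Sig (i : ℕ+) : BH := raise i

/-- The semicircular variables `Ξ_ℓ = i^ℓ Σ_ℓ + i^{-ℓ} Σ_ℓ^*`, for `ℓ = 1, 2, 3, …`. -/
def Xi (l : ℕ+) : BH :=
  Complex.I ^ (l : ℕ) • Sig l + (Complex.I ^ (l : ℕ))⁻¹ • star (Sig l)

/-- The involution of `B(H)` is the Hilbert space adjoint. -/
theorem toCLM_star (A : BH) : (star A).toCLM = ContinuousLinearMap.adjoint A.toCLM := rfl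

/-- The product of `B(H)` is composition of operators. -/
theorem toCLM_mul (A B : BH) : (A * B).toCLM = A.toCLM ∘L B.toCLM := rfl

/-- The vectorial state `φ(A) = (1_H, A 1_H)` on `B(H)`. -/
def state : BH →ₗ[ℂ] ℂ where
  toFun A := inner ℂ vacuum (A.toCLM vacuum)
  map_add' A B := inner_add_right (𝕜 := ℂ) vacuum
    (A.toCLM vacuum) (B.toCLM vacuum)
  map_smul' c A := inner_smul_right (𝕜 := ℂ) vacuum (A.toCLM vacuum) c

end BoltzmannFock

/-! ### Block algebras -/

/-- A transposition of a `*`-algebra. -/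
structure Transposition (A : Type*) [Ring A] [StarRing A] [Algebra ℂ A] where
  /-- the underlying linear map `a ↦ a^T` -/
  toLin : A →ₗ[ℂ] A
  involutive : ∀ a, toLin (toLin a) = a
  map_star : ∀ a, toLin (star a) = star (toLin a)
  map_mul : ∀ a b, toLin (a * b) = toLin b * toLin a

/-- A block algebra: a C*-algebra with a transposition, isomorphic, as algebra with involution
and transposition, to the algebra of `s × s` complex matrices for some `s > 0`. -/
class BlockAlgebra (S : Type*) [CStarAlgebra S] where
  /-- the transposition with which the block algebra is equipped -/
  transposition : Transposition S
  exists_iso : ∃ s : ℕ, 0 < s ∧ ∃ e : S ≃⋆ₐ[ℂ] Matrix (Fin s) (Fin s) ℂ,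
    ∀ x : S, e (transposition.toLin x) = Matrix.transpose (e x)

/-- The half-transpose map of `S ⊗ S`, given by `(x ⊗ y)^{1 ⊗ T} = x ⊗ y^T`. -/
def halfTranspose (S : Type*) [CStarAlgebra S] [BlockAlgebra S] : S ⊗[ℂ] S →ₗ[ℂ] S ⊗[ℂ] S :=
  TensorProduct.map LinearMap.id (BlockAlgebra.transposition (S := S)).toLin

/-! ### Extensions of states -/

/-- The `S`-linear extension of a functional `φ`; see `linExt_tmul`. -/
def linExt {A : Type*} [Ring A] [Algebra ℂ A] (φ : A →ₗ[ℂ] ℂ)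
    (S : Type*) [Ring S] [Algebra ℂ S] : A ⊗[ℂ] S →ₗ[ℂ] S :=
  (TensorProduct.lid ℂ S).toLinearMap ∘ₗ TensorProduct.map φ LinearMap.id

theorem linExt_tmul {A : Type*} [Ring A] [Algebra ℂ A] (φ : A →ₗ[ℂ] ℂ)
    (S : Type*) [Ring S] [Algebra ℂ S] (x : A) (y : S) :
    linExt φ S (x ⊗ₜ[ℂ] y) = φ x • y := by
  simp [linExt]

/-- The `S`-bilinear extension of a functional `φ`; see `bilinExt_tmul`. -/
def bilinExt {A : Type*} [Ring A] [Algebra ℂ A] (φ : A →ₗ[ℂ] ℂ)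
    (S : Type*) [Ring S] [Algebra ℂ S] :
    A ⊗[ℂ] S →ₗ[ℂ] A ⊗[ℂ] S →ₗ[ℂ] S ⊗[ℂ] S :=
  TensorProduct.curry
    ((TensorProduct.lid ℂ (S ⊗[ℂ] S)).toLinearMap
      ∘ₗ TensorProduct.map (φ ∘ₗ LinearMap.mul' ℂ A) LinearMap.id
      ∘ₗ (TensorProduct.tensorTensorTensorComm ℂ A S A S).toLinearMap)

theorem bilinExt_tmul {A : Type*} [Ring A] [Algebra ℂ A] (φ : A →ₗ[ℂ] ℂ)
    (S : Type*) [Ring S] [Algebra ℂ S] (x₁ x₂ : A) (y₁ y₂ : S) :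
    bilinExt φ S (x₁ ⊗ₜ[ℂ] y₁) (x₂ ⊗ₜ[ℂ] y₂) = φ (x₁ * x₂) • (y₁ ⊗ₜ[ℂ] y₂) := by
  simp [bilinExt]

/-! ### `S`-linear forms -/

/-- `L ∈ ℂ⟨X⟩ ⊗ S` is the `S`-linear form with Hamel expansion `L = ∑_ℓ X_ℓ ⊗ a_ℓ`, where the
Hamel coefficients `a_ℓ`, `ℓ = 1, 2, 3, …`, vanish for all but finitely many `ℓ`. -/
def HasHamelExpansion {S : Type*} [Ring S] [Algebra ℂ S]
    (L : FreeAlgebra ℂ ℕ+ ⊗[ℂ] S) (a : ℕ+ →₀ S) : Prop :=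
  L = a.sum fun l x => FreeAlgebra.ι ℂ l ⊗ₜ[ℂ] x

/-- The evaluation `L(ξ) ∈ A ⊗ S` at a sequence `ξ` in an algebra `A`: substitute `ξ_ℓ` for
`X_ℓ` in the first tensor factor. -/
def evalAt {A : Type*} [Ring A] [Algebra ℂ A] {S : Type*} [Ring S] [Algebra ℂ S]
    (L : FreeAlgebra ℂ ℕ+ ⊗[ℂ] S) (ξ : ℕ+ → A) : A ⊗[ℂ] S :=
  Algebra.TensorProduct.map (FreeAlgebra.lift ℂ ξ) (AlgHom.id ℂ S) L

theorem HasHamelExpansion.evalAt_eq {A : Type*} [Ring A] [Algebra ℂ A]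
    {S : Type*} [Ring S] [Algebra ℂ S] {L : FreeAlgebra ℂ ℕ+ ⊗[ℂ] S} {a : ℕ+ →₀ S}
    (h : HasHamelExpansion L a) (ξ : ℕ+ → A) :
    evalAt L ξ = a.sum fun l x => ξ l ⊗ₜ[ℂ] x := by
  rw [HasHamelExpansion] at h
  rw [evalAt, h, Finsupp.sum, map_sum]
  simp [Finsupp.sum]

/-! ### The special functions `G_L` and `G_{L₁,L₂}` -/

section SpecialFunctions

variable {S : Type*} [CStarAlgebra S]

/-- The element `L(Ξ) - 1 ⊗ Λ` of `B(H) ⊗ S`. -/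
def shifted (L : FreeAlgebra ℂ ℕ+ ⊗[ℂ] S) (Λ : S) :
    BoltzmannFock.BH ⊗[ℂ] S :=
  evalAt L BoltzmannFock.Xi - (1 : BoltzmannFock.BH) ⊗ₜ[ℂ] Λ

/-- The set `D_L` of those `Λ` for which `L(Ξ) - 1 ⊗ Λ` is invertible in `B(H) ⊗ S`. -/
def domainD (L : FreeAlgebra ℂ ℕ+ ⊗[ℂ] S) : Set S :=
  {Λ | IsUnit (shifted L Λ)}

/-- `G_L(Λ) = φ_S((L(Ξ) - 1 ⊗ Λ)⁻¹)`, meaningful for `Λ ∈ D_L`. -/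
def funG (L : FreeAlgebra ℂ ℕ+ ⊗[ℂ] S) (Λ : S) : S :=
  linExt BoltzmannFock.state S (Ring.inverse (shifted L Λ))

/-- `G_{L₁,L₂}(Λ₁,Λ₂) = φ_{S,S}((L₁(Ξ) - 1 ⊗ Λ₁)⁻¹, (L₂(Ξ) - 1 ⊗ Λ₂)⁻¹)`, meaningful for
`Λ₁ ∈ D_{L₁}` and `Λ₂ ∈ D_{L₂}`. -/
def funGG (L₁ L₂ : FreeAlgebra ℂ ℕ+ ⊗[ℂ] S) (Λ₁ Λ₂ : S) : S ⊗[ℂ] S :=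
  bilinExt BoltzmannFock.state S
    (Ring.inverse (shifted L₁ Λ₁)) (Ring.inverse (shifted L₂ Λ₂))

end SpecialFunctions

end

open scoped TensorProduct

noncomputable section

/-! ### Operators on Fock space and right-handed letter operators -/

namespace BoltzmannFock

/-! Write `R_i` for the operator appending the letter `i` on the right and `p` for the vacuum
projection. The `Ξ_ℓ` act on the left end of words, so they almost commute with `R_i` and `R_i^*`:
the commutators vanish for `ℓ ≠ i` and are multiples of `p` for `ℓ = i`. Hence `R_i` and `R_i^*`
pass through a resolvent `(L(Ξ) - 1 ⊗ Λ)⁻¹` at the cost of one term, resolvent times `p ⊗ a_i` times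
resolvent. The rank one projection `p` factors the state, so this term produces products of values
of `G`.

For one resolvent this gives `-(Λ + ∑ a_ℓ G a_ℓ) G = 1` (`schwingerDyson`); since `S` is
finite-dimensional, `G` is invertible. For two resolvents, insert between them the resolution of the
identity into `p`, the `R_i R_i^*` for `i` in a finite set containing the support of `a₂`, and a
remainder that kills the second resolvent applied to the vacuum. This gives `funGG_eq_add_sum`, a
linear equation in which the unknown is multiplied on the left in the first leg and on the right in
the second. The half-transpose turns both into left multiplications, and the equation becomes `M * U
= 1`, with `M` the claimed element and `U` the half-transpose of `G_{L₁,L₂}`. -/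

theorem inner_vec_left (w : List ℕ+) (x : Fock) : inner ℂ (vec w) x = x w := by
  simp [vec, lp.inner_single_left]

theorem inner_vec_vec (v w : List ℕ+) :
    inner ℂ (vec v) (vec w) = if v = w then (1 : ℂ) else 0 :=
  orthonormal_iff_ite.mp orthonormal_vec v w

theorem ext_inner_vec {x y : Fock} (h : ∀ w, inner ℂ (vec w) x = inner ℂ (vec w) y) : x = y := by
  refine lp.ext (funext fun w => ?_)
  simpa only [inner_vec_left] using h w

theorem BH.inner_star_left (A : BH) (x y : Fock) :
    inner ℂ ((star A).toCLM x) y = inner ℂ x (A.toCLM y) :=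
  ContinuousLinearMap.adjoint_inner_left A.toCLM y x

theorem BH.inner_star_right (A : BH) (x y : Fock) :
    inner ℂ x ((star A).toCLM y) = inner ℂ (A.toCLM x) y :=
  ContinuousLinearMap.adjoint_inner_right A.toCLM x y

/-- Bounded operators agreeing on the basis vectors are equal. -/
theorem BH.ext_vec {A B : BH} (h : ∀ w, A.toCLM (vec w) = B.toCLM (vec w)) : A = B := by
  -- Passing to adjoints puts the operators on basis vectors inside the inner product, so no density
  -- argument is needed.
  refine star_injective (ContinuousLinearMap.ext fun x => ext_inner_vec fun w => ?_)
  change inner ℂ (vec w) ((star A).toCLM x) = inner ℂ (vec w) ((star B).toCLM x)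
  rw [BH.inner_star_right, BH.inner_star_right, h]

theorem BH.toCLM_mul_apply (A B : BH) (x : Fock) : (A * B).toCLM x = A.toCLM (B.toCLM x) := rfl

theorem BH.toCLM_add_apply (A B : BH) (x : Fock) : (A + B).toCLM x = A.toCLM x + B.toCLM x := rfl

theorem BH.toCLM_sub_apply (A B : BH) (x : Fock) : (A - B).toCLM x = A.toCLM x - B.toCLM x := rfl

theorem BH.toCLM_one_apply (x : Fock) : (1 : BH).toCLM x = x := rfl

theorem BH.toCLM_sum_apply {ι : Type*} (s : Finset ι) (A : ι → BH) (x : Fock) :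
    (∑ i ∈ s, A i).toCLM x = ∑ i ∈ s, (A i).toCLM x :=
  map_sum (AddMonoidHom.mk' (fun B : BH => B.toCLM x) fun B C => BH.toCLM_add_apply B C x) A s

theorem Sig_vec (l : ℕ+) (w : List ℕ+) : (Sig l).toCLM (vec w) = vec (l :: w) := raise_vec l w

theorem orthonormal_vec_append (i : ℕ+) : Orthonormal ℂ (fun w : List ℕ+ => vec (w ++ [i])) :=
  orthonormal_vec.comp (fun w : List ℕ+ => w ++ [i]) (List.append_left_injective [i])

/-- The right raising operator, appending the letter `i` at the end of a word. -/
def rightRaise (i : ℕ+) : BH :=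
  (orthonormal_vec_append i).orthogonalFamily.linearIsometry.toContinuousLinearMap

theorem rightRaise_vec (i : ℕ+) (w : List ℕ+) :
    (rightRaise i).toCLM (vec w) = vec (w ++ [i]) := by
  change (orthonormal_vec_append i).orthogonalFamily.linearIsometry (vec w) = _
  rw [vec, OrthogonalFamily.linearIsometry_apply_single]
  simp

theorem star_rightRaise_vec_nil (i : ℕ+) : (star (rightRaise i)).toCLM (vec []) = 0 := by
  refine ext_inner_vec fun w => ?_
  rw [BH.inner_star_right, rightRaise_vec, inner_vec_vec, inner_zero_right, if_neg (by simp)]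

theorem star_rightRaise_vec_append (i j : ℕ+) (w : List ℕ+) :
    (star (rightRaise i)).toCLM (vec (w ++ [j])) = if i = j then vec w else 0 := by
  refine ext_inner_vec fun v => ?_
  rw [BH.inner_star_right, rightRaise_vec, inner_vec_vec]
  split_ifs with h₁ h₂ h₂
  · rw [inner_vec_vec, if_pos (List.append_inj_left' h₁ rfl)]
  · simp_all
  · rw [inner_vec_vec, if_neg]
    rintro rfl
    exact h₁ (by rw [h₂])
  · simp

/-- The orthogonal projection onto the vacuum vector. -/
def vacuumProj : BH := InnerProductSpace.rankOne ℂ vacuum vacuum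

theorem vacuumProj_apply (x : Fock) : vacuumProj.toCLM x = inner ℂ vacuum x • vacuum := by
  simp [vacuumProj, BH.toCLM]

theorem vacuumProj_vec_nil : vacuumProj.toCLM (vec []) = vec [] := by
  rw [vacuumProj_apply, vacuum, inner_vec_vec, if_pos rfl, one_smul]

theorem vacuumProj_vec_of_ne {w : List ℕ+} (hw : w ≠ []) : vacuumProj.toCLM (vec w) = 0 := by
  rw [vacuumProj_apply, vacuum, inner_vec_vec, if_neg hw.symm, zero_smul]

theorem star_vacuumProj : star vacuumProj = vacuumProj := by
  refine ContinuousLinearMap.ext fun x => ext_inner_vec fun w => ?_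
  change inner ℂ (vec w) ((star vacuumProj).toCLM x) = inner ℂ (vec w) (vacuumProj.toCLM x)
  rw [BH.inner_star_right, vacuumProj_apply, vacuumProj_apply, inner_smul_left, inner_smul_right,
    inner_conj_symm, mul_comm]

/-! ### Commutation relations -/

theorem Sig_mul_rightRaise (l i : ℕ+) : Sig l * rightRaise i = rightRaise i * Sig l := by
  refine BH.ext_vec fun w => ?_
  simp only [BH.toCLM_mul_apply, Sig_vec, rightRaise_vec, List.cons_append]

/-- Prepending a letter and deleting the last one are independent operations, except on the empty
word, where the prepended letter is itself the last one. -/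
theorem star_rightRaise_mul_Sig (i l : ℕ+) :
    star (rightRaise i) * Sig l = Sig l * star (rightRaise i) + if i = l then vacuumProj else 0 := by
  refine BH.ext_vec fun w => ?_
  rw [BH.toCLM_add_apply, BH.toCLM_mul_apply, BH.toCLM_mul_apply, Sig_vec]
  rcases List.eq_nil_or_concat' w with rfl | ⟨u, j, rfl⟩
  · have h := star_rightRaise_vec_append i l []
    rw [List.nil_append] at h
    rw [h, star_rightRaise_vec_nil, map_zero, zero_add]
    split_ifs
    · rw [vacuumProj_vec_nil]
    · rfl
  · have h : (if i = l then vacuumProj else 0).toCLM (vec (u ++ [j])) = 0 := by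
      split_ifs
      · exact vacuumProj_vec_of_ne (by simp)
      · rfl
    rw [← List.cons_append, star_rightRaise_vec_append, star_rightRaise_vec_append, h, add_zero]
    split_ifs
    · rw [Sig_vec]
    · rw [map_zero]

theorem star_rightRaise_mul_star_Sig (i l : ℕ+) :
    star (rightRaise i) * star (Sig l) = star (Sig l) * star (rightRaise i) := by
  rw [← star_mul, ← star_mul, Sig_mul_rightRaise]

theorem star_Sig_mul_rightRaise (i l : ℕ+) :
    star (Sig l) * rightRaise i = rightRaise i * star (Sig l) + if i = l then vacuumProj else 0 := by
  have h := congrArg star (star_rightRaise_mul_Sig i l)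
  rw [star_mul, star_star, star_add, star_mul, star_star] at h
  rw [h]
  split_ifs
  · rw [star_vacuumProj]
  · rw [star_zero]

theorem star_rightRaise_mul_Xi (i l : ℕ+) :
    star (rightRaise i) * Xi l = Xi l * star (rightRaise i)
      + if i = l then Complex.I ^ (i : ℕ) • vacuumProj else 0 := by
  rw [Xi, mul_add, add_mul, mul_smul_comm, mul_smul_comm, star_rightRaise_mul_Sig,
    star_rightRaise_mul_star_Sig, smul_mul_assoc, smul_mul_assoc, smul_add]
  split_ifs with h
  · subst h; abel
  · simp

theorem Xi_mul_rightRaise (i l : ℕ+) :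
    Xi l * rightRaise i = rightRaise i * Xi l
      + if i = l then (Complex.I ^ (i : ℕ))⁻¹ • vacuumProj else 0 := by
  rw [Xi, mul_add, add_mul, mul_smul_comm, mul_smul_comm, smul_mul_assoc, smul_mul_assoc,
    star_Sig_mul_rightRaise, Sig_mul_rightRaise, smul_add]
  split_ifs with h
  · subst h; abel
  · simp

/-! ### Vacuum matrix elements -/

theorem state_apply (A : BH) : state A = inner ℂ vacuum (A.toCLM vacuum) := rfl

theorem state_one : state 1 = 1 := by
  rw [state_apply, BH.toCLM_one_apply, vacuum, inner_vec_vec, if_pos rfl]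

/-- This factorization is what makes the commutator terms computable in terms of `G`. -/
theorem state_mul_vacuumProj_mul (A B : BH) : state (A * vacuumProj * B) = state A * state B := by
  rw [state_apply, BH.toCLM_mul_apply, BH.toCLM_mul_apply, vacuumProj_apply, map_smul,
    inner_smul_right, mul_comm]
  rfl

theorem state_rightRaise_mul (i : ℕ+) (A : BH) : state (rightRaise i * A) = 0 := by
  rw [state_apply, BH.toCLM_mul_apply, ← BH.inner_star_left, vacuum, star_rightRaise_vec_nil,
    inner_zero_left]

/-- `Σ_ℓ^*` kills the vacuum, and `Σ_ℓ`, `R_ℓ` both send it to `v(ℓ)`; so next to the vacuum a left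
annihilator may be traded for a right one. -/
theorem state_Xi_mul (l : ℕ+) (A : BH) :
    state (Xi l * A) = (Complex.I ^ (l : ℕ))⁻¹ * state (star (rightRaise l) * A) := by
  have h₁ : (star (Sig l)).toCLM vacuum = 0 := by
    refine ext_inner_vec fun w => ?_
    rw [BH.inner_star_right, Sig_vec, vacuum, inner_vec_vec, inner_zero_right, if_neg (by simp)]
  have h₂ : state (Sig l * A) = 0 := by
    rw [state_apply, BH.toCLM_mul_apply, ← BH.inner_star_left, h₁, inner_zero_left]
  have h₃ : state (star (Sig l) * A) = state (star (rightRaise l) * A) := by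
    rw [state_apply, state_apply, BH.toCLM_mul_apply, BH.toCLM_mul_apply, BH.inner_star_right,
      BH.inner_star_right, vacuum, Sig_vec, rightRaise_vec, List.nil_append]
  rw [Xi, add_mul, smul_mul_assoc, smul_mul_assoc, map_add, map_smul, map_smul, h₂, h₃]
  simp

/-- The matrix element `A ↦ (v(w), A 1_H)`. -/
def vacuumColumn (w : List ℕ+) : BH →ₗ[ℂ] ℂ where
  toFun A := inner ℂ (vec w) (A.toCLM vacuum)
  map_add' A B := inner_add_right (𝕜 := ℂ) (vec w) (A.toCLM vacuum) (B.toCLM vacuum)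
  map_smul' c A := inner_smul_right (𝕜 := ℂ) (vec w) (A.toCLM vacuum) c

theorem vacuumColumn_apply (w : List ℕ+) (A : BH) :
    vacuumColumn w A = inner ℂ (vec w) (A.toCLM vacuum) := rfl

theorem vacuumColumn_nil : vacuumColumn [] = state := rfl

theorem vacuumColumn_mul_star_rightRaise (w : List ℕ+) (A : BH) (i : ℕ+) :
    vacuumColumn w (A * star (rightRaise i)) = 0 := by
  rw [vacuumColumn_apply, BH.toCLM_mul_apply, vacuum, star_rightRaise_vec_nil, map_zero,
    inner_zero_right]

theorem vacuumColumn_star_rightRaise_mul (w : List ℕ+) (i : ℕ+) (A : BH) :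
    vacuumColumn w (star (rightRaise i) * A) = vacuumColumn (w ++ [i]) A := by
  rw [vacuumColumn_apply, BH.toCLM_mul_apply, BH.inner_star_right, rightRaise_vec]
  rfl

theorem state_mul_eq_zero {B : BH} (h : ∀ w, vacuumColumn w B = 0) (A : BH) :
    state (A * B) = 0 := by
  have hB : B.toCLM vacuum = 0 :=
    ext_inner_vec fun w => by rw [inner_zero_right]; exact h w
  rw [state_apply, BH.toCLM_mul_apply, hB, map_zero, inner_zero_right]

/-- The projection onto the span of the nonempty words whose last letter is outside `s`. -/
def lastLetterCompl (s : Finset ℕ+) : BH :=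
  1 - vacuumProj - ∑ i ∈ s, rightRaise i * star (rightRaise i)

theorem star_lastLetterCompl (s : Finset ℕ+) : star (lastLetterCompl s) = lastLetterCompl s := by
  simp [lastLetterCompl, star_vacuumProj]

theorem lastLetterCompl_vec_nil (s : Finset ℕ+) : (lastLetterCompl s).toCLM (vec []) = 0 := by
  simp [lastLetterCompl, BH.toCLM_sub_apply, BH.toCLM_one_apply, BH.toCLM_sum_apply,
    BH.toCLM_mul_apply, vacuumProj_vec_nil, star_rightRaise_vec_nil]

theorem lastLetterCompl_vec_append (s : Finset ℕ+) (w : List ℕ+) (j : ℕ+) :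
    (lastLetterCompl s).toCLM (vec (w ++ [j])) = if j ∈ s then 0 else vec (w ++ [j]) := by
  have h (i : ℕ+) : (rightRaise i).toCLM ((star (rightRaise i)).toCLM (vec (w ++ [j])))
      = if i = j then vec (w ++ [j]) else 0 := by
    rw [star_rightRaise_vec_append]
    split_ifs with hij
    · rw [rightRaise_vec, hij]
    · rw [map_zero]
  rw [lastLetterCompl, BH.toCLM_sub_apply, BH.toCLM_sub_apply, BH.toCLM_one_apply,
    vacuumProj_vec_of_ne (by simp), BH.toCLM_sum_apply]
  simp only [BH.toCLM_mul_apply, h, Finset.sum_ite_eq']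
  split_ifs <;> simp

theorem vacuumColumn_lastLetterCompl_mul (s : Finset ℕ+) (w : List ℕ+) (A : BH) :
    vacuumColumn w (lastLetterCompl s * A)
      = inner ℂ ((lastLetterCompl s).toCLM (vec w)) (A.toCLM vacuum) := by
  rw [vacuumColumn_apply, BH.toCLM_mul_apply, ← BH.inner_star_left, star_lastLetterCompl]

end BoltzmannFock

/-! ### Calculus of the `S`-linear and `S`-bilinear extensions -/

section Extensions

variable {A : Type*} [Ring A] [Algebra ℂ A] {S : Type*} [Ring S] [Algebra ℂ S]

theorem linExt_zero : linExt (0 : A →ₗ[ℂ] ℂ) S = 0 := by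
  simp [linExt]

theorem linExt_tmul_mul (φ : A →ₗ[ℂ] ℂ) (x : A) (s : S) (Y : A ⊗[ℂ] S) :
    linExt φ S (x ⊗ₜ s * Y) = s * linExt (φ ∘ₗ LinearMap.mulLeft ℂ x) S Y := by
  induction Y with
  | zero => simp
  | add Y₁ Y₂ h₁ h₂ => rw [mul_add, map_add, map_add, h₁, h₂, mul_add]
  | tmul y t => simp [linExt_tmul]

theorem linExt_mul_tmul (φ : A →ₗ[ℂ] ℂ) (x : A) (s : S) (Y : A ⊗[ℂ] S) :
    linExt φ S (Y * x ⊗ₜ s) = linExt (φ ∘ₗ LinearMap.mulRight ℂ x) S Y * s := by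
  induction Y with
  | zero => simp
  | add Y₁ Y₂ h₁ h₂ => rw [add_mul, map_add, map_add, h₁, h₂, add_mul]
  | tmul y t => simp [linExt_tmul]

/-- The scalar legs never meet, so only a factor with trivial `S`-part can cross from one argument
to the other. -/
theorem bilinExt_mul_tmul_one (φ : A →ₗ[ℂ] ℂ) (X Y : A ⊗[ℂ] S) (x : A) :
    bilinExt φ S (X * x ⊗ₜ 1) Y = bilinExt φ S X (x ⊗ₜ 1 * Y) := by
  induction X with
  | zero => simp
  | add X₁ X₂ h₁ h₂ =>
    rw [add_mul, map_add, map_add, LinearMap.add_apply, LinearMap.add_apply, h₁, h₂]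
  | tmul y t =>
    induction Y with
    | zero => simp
    | add Y₁ Y₂ h₁ h₂ => rw [mul_add, map_add, map_add, h₁, h₂]
    | tmul z u => simp [bilinExt_tmul, mul_assoc]

theorem bilinExt_eq_zero_of_left {φ : A →ₗ[ℂ] ℂ} {x : A} (h : ∀ y, φ (x * y) = 0)
    (X Y : A ⊗[ℂ] S) : bilinExt φ S (x ⊗ₜ 1 * X) Y = 0 := by
  induction X with
  | zero => simp
  | add X₁ X₂ h₁ h₂ => rw [mul_add, map_add, LinearMap.add_apply, h₁, h₂, add_zero]
  | tmul y t =>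
    induction Y with
    | zero => simp
    | add Y₁ Y₂ h₁ h₂ => rw [map_add, h₁, h₂, add_zero]
    | tmul z u => simp [bilinExt_tmul, mul_assoc, h]

theorem bilinExt_eq_zero_of_right {φ : A →ₗ[ℂ] ℂ} {x : A} (h : ∀ y, φ (y * x) = 0)
    (X Y : A ⊗[ℂ] S) : bilinExt φ S X (Y * x ⊗ₜ 1) = 0 := by
  induction X with
  | zero => simp
  | add X₁ X₂ h₁ h₂ => rw [map_add, LinearMap.add_apply, h₁, h₂, add_zero]
  | tmul y t =>
    induction Y with
    | zero => simp
    | add Y₁ Y₂ h₁ h₂ => rw [add_mul, map_add, h₁, h₂, add_zero]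
    | tmul z u => simp [bilinExt_tmul, ← mul_assoc, h]

theorem linExt_mul_mul_of_factor {φ : A →ₗ[ℂ] ℂ} {p : A}
    (hp : ∀ x y, φ (x * p * y) = φ x * φ y) (X Y : A ⊗[ℂ] S) (s : S) :
    linExt φ S (X * p ⊗ₜ s * Y) = linExt φ S X * s * linExt φ S Y := by
  induction X with
  | zero => simp
  | add X₁ X₂ h₁ h₂ => simp only [add_mul, map_add, h₁, h₂]
  | tmul x t =>
    induction Y with
    | zero => simp
    | add Y₁ Y₂ h₁ h₂ => simp only [mul_add, map_add, h₁, h₂]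
    | tmul y u => simp [linExt_tmul, hp, smul_smul, mul_comm]

theorem bilinExt_mul_mul_left_of_factor {φ : A →ₗ[ℂ] ℂ} {p : A}
    (hp : ∀ x y, φ (x * p * y) = φ x * φ y) (X X' Y : A ⊗[ℂ] S) (s : S) :
    bilinExt φ S (X * p ⊗ₜ s * X') Y
      = (linExt φ S X * s) ⊗ₜ[ℂ] 1 * bilinExt φ S X' Y := by
  induction X with
  | zero => simp
  | add X₁ X₂ h₁ h₂ =>
    simp only [add_mul, map_add, LinearMap.add_apply, h₁, h₂, TensorProduct.add_tmul]
  | tmul x t =>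
    induction X' with
    | zero => simp
    | add X₁ X₂ h₁ h₂ => simp only [mul_add, map_add, LinearMap.add_apply, h₁, h₂]
    | tmul x' t' =>
      induction Y with
      | zero => simp
      | add Y₁ Y₂ h₁ h₂ => simp only [mul_add, map_add, h₁, h₂]
      | tmul y u =>
        have h := hp x (x' * y)
        rw [← mul_assoc] at h
        simp [linExt_tmul, bilinExt_tmul, h, smul_smul, mul_comm, TensorProduct.smul_tmul']

theorem bilinExt_mul_mul_right_of_factor {φ : A →ₗ[ℂ] ℂ} {p : A}
    (hp : ∀ x y, φ (x * p * y) = φ x * φ y) (X Y Y' : A ⊗[ℂ] S) (s : S) :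
    bilinExt φ S X (Y * p ⊗ₜ s * Y')
      = bilinExt φ S X Y * 1 ⊗ₜ[ℂ] (s * linExt φ S Y') := by
  induction X with
  | zero => simp
  | add X₁ X₂ h₁ h₂ => simp only [add_mul, map_add, LinearMap.add_apply, h₁, h₂]
  | tmul x t =>
    induction Y with
    | zero => simp
    | add Y₁ Y₂ h₁ h₂ => simp only [add_mul, map_add, h₁, h₂]
    | tmul y u =>
      induction Y' with
      | zero => simp
      | add Y₁ Y₂ h₁ h₂ => simp only [mul_add, map_add, h₁, h₂, TensorProduct.tmul_add]
      | tmul y' u' =>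
        have h := hp (x * y) y'
        simp only [mul_assoc] at h
        simp [linExt_tmul, bilinExt_tmul, h, smul_smul, mul_comm, mul_assoc]

theorem bilinExt_one_right (φ : A →ₗ[ℂ] ℂ) (X : A ⊗[ℂ] S) :
    bilinExt φ S X 1 = linExt φ S X ⊗ₜ[ℂ] 1 := by
  induction X with
  | zero => simp
  | add X₁ X₂ h₁ h₂ => rw [map_add, LinearMap.add_apply, h₁, h₂, map_add, TensorProduct.add_tmul]
  | tmul x t =>
    rw [Algebra.TensorProduct.one_def, bilinExt_tmul, linExt_tmul, mul_one,
      TensorProduct.smul_tmul']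

/-- If the functionals `φ (x * ·)` vanish on the common kernel of the `ψ i`, then `bilinExt φ S X`
vanishes on the common kernel of the extensions `linExt (ψ i) S`. -/
theorem bilinExt_eq_zero_of_linExt_eq_zero {ι : Type*} {φ : A →ₗ[ℂ] ℂ} {ψ : ι → A →ₗ[ℂ] ℂ}
    (hψ : ∀ y, (∀ i, ψ i y = 0) → ∀ x, φ (x * y) = 0) {Y : A ⊗[ℂ] S}
    (hY : ∀ i, linExt (ψ i) S Y = 0) (X : A ⊗[ℂ] S) : bilinExt φ S X Y = 0 := by
  -- Expanding the `S`-leg in a basis reduces the hypothesis on `Y` to one on each coefficient, by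
  -- linear independence.
  let b := Module.Basis.ofVectorSpace ℂ S
  obtain ⟨y, rfl⟩ := TensorProduct.eq_repr_basis_right b Y
  have hy (k) (i : ι) : ψ i (y k) = 0 := by
    have h := hY i
    simp only [Finsupp.sum, map_sum, linExt_tmul] at h
    by_cases hk : k ∈ y.support
    · exact linearIndependent_iff'.mp b.linearIndependent y.support (fun k => ψ i (y k)) h k hk
    · rw [Finsupp.notMem_support_iff.mp hk, map_zero]
  rw [Finsupp.sum, map_sum]
  refine Finset.sum_eq_zero fun k _ => ?_
  induction X with
  | zero => simp
  | add X₁ X₂ h₁ h₂ => rw [map_add, LinearMap.add_apply, h₁, h₂, add_zero]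
  | tmul x t => rw [bilinExt_tmul, hψ _ (hy k), zero_smul]

end Extensions

/-! ### Commutators with resolvents and the equations for `G` -/

section Resolvent

open BoltzmannFock

variable {S : Type*} [CStarAlgebra S] {L : FreeAlgebra ℂ ℕ+ ⊗[ℂ] S} {a : ℕ+ →₀ S}

theorem HasHamelExpansion.star_rightRaise_mul_shifted (hL : HasHamelExpansion L a) (Λ : S)
    (i : ℕ+) :
    star (rightRaise i) ⊗ₜ[ℂ] 1 * shifted L Λ = shifted L Λ * star (rightRaise i) ⊗ₜ[ℂ] 1
      + Complex.I ^ (i : ℕ) • vacuumProj ⊗ₜ[ℂ] a i := by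
  have h : star (rightRaise i) ⊗ₜ[ℂ] 1 * evalAt L Xi = evalAt L Xi * star (rightRaise i) ⊗ₜ[ℂ] 1
      + Complex.I ^ (i : ℕ) • vacuumProj ⊗ₜ[ℂ] a i := by
    simp only [hL.evalAt_eq, Finsupp.sum, Finset.mul_sum, Finset.sum_mul,
      Algebra.TensorProduct.tmul_mul_tmul, one_mul, mul_one, star_rightRaise_mul_Xi,
      TensorProduct.add_tmul, Finset.sum_add_distrib, TensorProduct.ite_tmul, Finset.sum_ite_eq]
    split_ifs with hi
    · rw [TensorProduct.smul_tmul']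
    · rw [Finsupp.notMem_support_iff.mp hi, TensorProduct.tmul_zero, smul_zero]
  rw [shifted, mul_sub, sub_mul, h]
  simp only [Algebra.TensorProduct.tmul_mul_tmul, one_mul, mul_one]
  abel

theorem HasHamelExpansion.shifted_mul_rightRaise (hL : HasHamelExpansion L a) (Λ : S)
    (i : ℕ+) :
    shifted L Λ * rightRaise i ⊗ₜ[ℂ] 1 = rightRaise i ⊗ₜ[ℂ] 1 * shifted L Λ
      + (Complex.I ^ (i : ℕ))⁻¹ • vacuumProj ⊗ₜ[ℂ] a i := by
  have h : evalAt L Xi * rightRaise i ⊗ₜ[ℂ] 1 = rightRaise i ⊗ₜ[ℂ] 1 * evalAt L Xi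
      + (Complex.I ^ (i : ℕ))⁻¹ • vacuumProj ⊗ₜ[ℂ] a i := by
    simp only [hL.evalAt_eq, Finsupp.sum, Finset.mul_sum, Finset.sum_mul,
      Algebra.TensorProduct.tmul_mul_tmul, one_mul, mul_one, Xi_mul_rightRaise,
      TensorProduct.add_tmul, Finset.sum_add_distrib, TensorProduct.ite_tmul, Finset.sum_ite_eq]
    split_ifs with hi
    · rw [TensorProduct.smul_tmul']
    · rw [Finsupp.notMem_support_iff.mp hi, TensorProduct.tmul_zero, smul_zero]
  rw [shifted, mul_sub, sub_mul, h]
  simp only [Algebra.TensorProduct.tmul_mul_tmul, one_mul, mul_one]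
  abel

variable {Λ : S}

/-- Multiply the commutation relation for `shifted` by the resolvent on both sides. -/
theorem HasHamelExpansion.star_rightRaise_mul_resolvent (hL : HasHamelExpansion L a)
    (hΛ : Λ ∈ domainD L) (i : ℕ+) :
    star (rightRaise i) ⊗ₜ[ℂ] 1 * Ring.inverse (shifted L Λ)
      = Ring.inverse (shifted L Λ) * star (rightRaise i) ⊗ₜ[ℂ] 1
        - Complex.I ^ (i : ℕ) • (Ring.inverse (shifted L Λ) * vacuumProj ⊗ₜ[ℂ] a i
          * Ring.inverse (shifted L Λ)) := by
  have h := congrArg (fun X => Ring.inverse (shifted L Λ) * X * Ring.inverse (shifted L Λ))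
    (hL.star_rightRaise_mul_shifted Λ i)
  simp only [mul_add, add_mul, mul_assoc, Ring.mul_inverse_cancel _ hΛ, mul_one,
    Ring.inverse_mul_cancel_left _ _ hΛ, mul_smul_comm, smul_mul_assoc] at h
  rw [h, mul_assoc, add_sub_cancel_right]

theorem HasHamelExpansion.resolvent_mul_rightRaise (hL : HasHamelExpansion L a)
    (hΛ : Λ ∈ domainD L) (i : ℕ+) :
    Ring.inverse (shifted L Λ) * rightRaise i ⊗ₜ[ℂ] 1
      = rightRaise i ⊗ₜ[ℂ] 1 * Ring.inverse (shifted L Λ)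
        - (Complex.I ^ (i : ℕ))⁻¹ • (Ring.inverse (shifted L Λ) * vacuumProj ⊗ₜ[ℂ] a i
          * Ring.inverse (shifted L Λ)) := by
  have h := congrArg (fun X => Ring.inverse (shifted L Λ) * X * Ring.inverse (shifted L Λ))
    (hL.shifted_mul_rightRaise Λ i)
  simp only [mul_add, add_mul, mul_assoc, Ring.mul_inverse_cancel _ hΛ, mul_one,
    Ring.inverse_mul_cancel_left _ _ hΛ, mul_smul_comm, smul_mul_assoc] at h
  rw [h, mul_assoc, add_sub_cancel_right]

theorem linExt_vacuumColumn_mul_star_rightRaise (w : List ℕ+) (i : ℕ+) (X : BH ⊗[ℂ] S) :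
    linExt (vacuumColumn w) S (X * star (rightRaise i) ⊗ₜ[ℂ] 1) = 0 := by
  have h : vacuumColumn w ∘ₗ LinearMap.mulRight ℂ (star (rightRaise i)) = 0 :=
    LinearMap.ext fun A => vacuumColumn_mul_star_rightRaise w A i
  rw [linExt_mul_tmul, h, linExt_zero, LinearMap.zero_apply, zero_mul]

/-- The Schwinger-Dyson equation. -/
theorem HasHamelExpansion.schwingerDyson (hL : HasHamelExpansion L a) (hΛ : Λ ∈ domainD L) :
    -(Λ + a.sum fun _ x => x * funG L Λ * x) * funG L Λ = 1 := by
  have hXi (l : ℕ+) : linExt state S (Xi l ⊗ₜ[ℂ] a l * Ring.inverse (shifted L Λ))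
      = -(a l * funG L Λ * a l * funG L Λ) := by
    have h₁ : state ∘ₗ LinearMap.mulLeft ℂ (Xi l)
        = (Complex.I ^ (l : ℕ))⁻¹ • (state ∘ₗ LinearMap.mulLeft ℂ (star (rightRaise l))) :=
      LinearMap.ext fun A => state_Xi_mul l A
    have h₂ : linExt state S (Xi l ⊗ₜ[ℂ] a l * Ring.inverse (shifted L Λ))
        = a l * (Complex.I ^ (l : ℕ))⁻¹ •
          linExt state S (star (rightRaise l) ⊗ₜ[ℂ] 1 * Ring.inverse (shifted L Λ)) := by
      rw [linExt_tmul_mul, linExt_tmul_mul, one_mul, h₁]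
      simp [linExt, TensorProduct.map_smul_left]
    rw [h₂, hL.star_rightRaise_mul_resolvent hΛ, map_sub, ← vacuumColumn_nil,
      linExt_vacuumColumn_mul_star_rightRaise, vacuumColumn_nil, map_smul,
      linExt_mul_mul_of_factor state_mul_vacuumProj_mul, zero_sub, smul_neg, smul_smul,
      inv_mul_cancel₀ (pow_ne_zero _ Complex.I_ne_zero), one_smul, mul_neg]
    simp only [funG, mul_assoc]
  have hΛ' : linExt state S ((1 : BH) ⊗ₜ[ℂ] Λ * Ring.inverse (shifted L Λ)) = Λ * funG L Λ := by
    rw [linExt_tmul_mul, LinearMap.mulLeft_one, LinearMap.comp_id, funG]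
  have h := congrArg (linExt state S) (Ring.mul_inverse_cancel _ hΛ)
  -- Only the left factor is expanded; the resolvent must stay intact.
  nth_rw 1 [shifted] at h
  rw [sub_mul, map_sub, hΛ', hL.evalAt_eq, Finsupp.sum, Finset.sum_mul, map_sum,
    Algebra.TensorProduct.one_def, linExt_tmul, state_one, one_smul] at h
  simp only [hXi] at h
  rw [← h, Finsupp.sum, neg_mul, add_mul, Finset.sum_mul, Finset.sum_neg_distrib]
  abel

/-- If `j ∉ s` then `a j = 0`, so `R_j^*` commutes with the resolvent and then kills the vacuum: the
resolvent creates no word ending in `j`. -/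
theorem HasHamelExpansion.linExt_vacuumColumn_lastLetterCompl_mul_resolvent
    (hL : HasHamelExpansion L a) (hΛ : Λ ∈ domainD L)
    {s : Finset ℕ+} (hs : a.support ⊆ s) (w : List ℕ+) :
    linExt (vacuumColumn w) S
      (lastLetterCompl s ⊗ₜ[ℂ] 1 * Ring.inverse (shifted L Λ)) = 0 := by
  rw [linExt_tmul_mul, one_mul]
  have hzero (h : (lastLetterCompl s).toCLM (vec w) = 0) :
      vacuumColumn w ∘ₗ LinearMap.mulLeft ℂ (lastLetterCompl s) = 0 := by
    refine LinearMap.ext fun A => ?_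
    rw [LinearMap.comp_apply, LinearMap.mulLeft_apply, vacuumColumn_lastLetterCompl_mul, h,
      inner_zero_left, LinearMap.zero_apply]
  rcases List.eq_nil_or_concat' w with rfl | ⟨u, j, rfl⟩
  · rw [hzero (lastLetterCompl_vec_nil s), linExt_zero, LinearMap.zero_apply]
  by_cases hj : j ∈ s
  · rw [hzero (by rw [lastLetterCompl_vec_append, if_pos hj]), linExt_zero, LinearMap.zero_apply]
  · have h : vacuumColumn (u ++ [j]) ∘ₗ LinearMap.mulLeft ℂ (lastLetterCompl s)
        = vacuumColumn u ∘ₗ LinearMap.mulLeft ℂ (star (rightRaise j)) := by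
      refine LinearMap.ext fun A => ?_
      rw [LinearMap.comp_apply, LinearMap.comp_apply, LinearMap.mulLeft_apply,
        LinearMap.mulLeft_apply, vacuumColumn_lastLetterCompl_mul, lastLetterCompl_vec_append,
        if_neg hj, vacuumColumn_star_rightRaise_mul, vacuumColumn_apply]
    have haj : a j = 0 := Finsupp.notMem_support_iff.mp fun h => hj (hs h)
    rw [h, ← one_mul (linExt _ S _), ← linExt_tmul_mul, hL.star_rightRaise_mul_resolvent hΛ,
      haj, TensorProduct.tmul_zero, mul_zero, zero_mul, smul_zero, sub_zero,
      linExt_vacuumColumn_mul_star_rightRaise]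

/-- The fixed point equation for the two-variable function `funGG`. -/
theorem funGG_eq_add_sum {L₁ L₂ : FreeAlgebra ℂ ℕ+ ⊗[ℂ] S} {a₁ a₂ : ℕ+ →₀ S}
    (hL₁ : HasHamelExpansion L₁ a₁) (hL₂ : HasHamelExpansion L₂ a₂) {Λ₁ Λ₂ : S}
    (hΛ₁ : Λ₁ ∈ domainD L₁) (hΛ₂ : Λ₂ ∈ domainD L₂) {s : Finset ℕ+} (hs : a₂.support ⊆ s) :
    funGG L₁ L₂ Λ₁ Λ₂ = funG L₁ Λ₁ ⊗ₜ[ℂ] funG L₂ Λ₂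
      + ∑ i ∈ s, (funG L₁ Λ₁ * a₁ i) ⊗ₜ[ℂ] 1 * funGG L₁ L₂ Λ₁ Λ₂
        * 1 ⊗ₜ[ℂ] (a₂ i * funG L₂ Λ₂) := by
  have hterm (i : ℕ+) : bilinExt state S (Ring.inverse (shifted L₁ Λ₁))
      ((rightRaise i * star (rightRaise i)) ⊗ₜ[ℂ] 1 * Ring.inverse (shifted L₂ Λ₂))
      = (funG L₁ Λ₁ * a₁ i) ⊗ₜ[ℂ] 1 * funGG L₁ L₂ Λ₁ Λ₂ * 1 ⊗ₜ[ℂ] (a₂ i * funG L₂ Λ₂) := by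
    have h : (rightRaise i * star (rightRaise i)) ⊗ₜ[ℂ] (1 : S)
        = rightRaise i ⊗ₜ[ℂ] 1 * star (rightRaise i) ⊗ₜ[ℂ] 1 := by
      rw [Algebra.TensorProduct.tmul_mul_tmul, one_mul]
    have hstar (A : BH) : state (A * star (rightRaise i)) = 0 :=
      vacuumColumn_mul_star_rightRaise [] A i
    -- `R_i` moves left and `R_i^*` right until they meet the vacuum and vanish. Only the two
    -- commutator terms survive; their minus signs and their phases `i^{∓i}` cancel.
    rw [h, mul_assoc, ← bilinExt_mul_tmul_one, hL₁.resolvent_mul_rightRaise hΛ₁, map_sub,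
      LinearMap.sub_apply, bilinExt_eq_zero_of_left (state_rightRaise_mul i), zero_sub, map_smul,
      LinearMap.smul_apply, bilinExt_mul_mul_left_of_factor state_mul_vacuumProj_mul,
      hL₂.star_rightRaise_mul_resolvent hΛ₂, map_sub, bilinExt_eq_zero_of_right hstar, zero_sub,
      map_smul, bilinExt_mul_mul_right_of_factor state_mul_vacuumProj_mul, mul_neg, smul_neg,
      neg_neg, mul_smul_comm, smul_smul, inv_mul_cancel₀ (pow_ne_zero _ Complex.I_ne_zero),
      one_smul, ← mul_assoc]
    rfl
  have hvac : bilinExt state S (Ring.inverse (shifted L₁ Λ₁))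
      (vacuumProj ⊗ₜ[ℂ] 1 * Ring.inverse (shifted L₂ Λ₂))
      = funG L₁ Λ₁ ⊗ₜ[ℂ] funG L₂ Λ₂ := by
    have h := bilinExt_mul_mul_right_of_factor state_mul_vacuumProj_mul
      (Ring.inverse (shifted L₁ Λ₁)) 1 (Ring.inverse (shifted L₂ Λ₂)) 1
    rwa [one_mul, bilinExt_one_right, Algebra.TensorProduct.tmul_mul_tmul, mul_one, one_mul,
      one_mul] at h
  -- The remainder of the resolution of the identity contributes zero; expanding it yields the
  -- equation.
  have h := bilinExt_eq_zero_of_linExt_eq_zero (φ := state) (ψ := vacuumColumn)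
    (fun y hy x => state_mul_eq_zero hy x)
    (hL₂.linExt_vacuumColumn_lastLetterCompl_mul_resolvent hΛ₂ hs) (Ring.inverse (shifted L₁ Λ₁))
  rw [lastLetterCompl, TensorProduct.sub_tmul, TensorProduct.sub_tmul, TensorProduct.sum_tmul,
    ← Algebra.TensorProduct.one_def, sub_mul, sub_mul, one_mul, Finset.sum_mul, map_sub, map_sub,
    map_sum, hvac, sub_sub, sub_eq_zero] at h
  simp only [hterm] at h
  exact h

end Resolvent

/-! ### The half-transpose -/

section HalfTranspose

theorem Transposition.map_one {A : Type*} [Ring A] [StarRing A] [Algebra ℂ A]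
    (t : Transposition A) : t.toLin 1 = 1 := by
  have h := t.map_mul 1 (t.toLin 1)
  rwa [one_mul, t.involutive, one_mul, eq_comm] at h

variable {S : Type*} [CStarAlgebra S] [BlockAlgebra S]

theorem BlockAlgebra.finiteDimensional (S : Type*) [CStarAlgebra S] [BlockAlgebra S] :
    FiniteDimensional ℂ S := by
  obtain ⟨s, -, e, -⟩ := BlockAlgebra.exists_iso (S := S)
  exact Module.Finite.equiv e.toAlgEquiv.symm.toLinearEquiv

theorem halfTranspose_tmul (x y : S) :
    halfTranspose S (x ⊗ₜ y) = x ⊗ₜ (BlockAlgebra.transposition (S := S)).toLin y := rfl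

theorem halfTranspose_involutive (X : S ⊗[ℂ] S) : halfTranspose S (halfTranspose S X) = X := by
  induction X with
  | zero => simp
  | add X Y hX hY => rw [map_add, map_add, hX, hY]
  | tmul x y => rw [halfTranspose_tmul, halfTranspose_tmul, Transposition.involutive]

/-- Antimultiplicativity of `T` turns right multiplication in the second leg into left
multiplication. -/
theorem halfTranspose_mul_mul (x y : S) (X : S ⊗[ℂ] S) :
    halfTranspose S (x ⊗ₜ 1 * X * 1 ⊗ₜ y)
      = x ⊗ₜ (BlockAlgebra.transposition (S := S)).toLin y * halfTranspose S X := by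
  induction X with
  | zero => simp
  | add X Y hX hY => rw [mul_add, add_mul, map_add, map_add, hX, hY, mul_add]
  | tmul u v =>
    simp only [Algebra.TensorProduct.tmul_mul_tmul, halfTranspose_tmul, mul_one, one_mul,
      Transposition.map_mul]

end HalfTranspose

/-! ### Solving the fixed point equation -/

theorem proposition5p6 {S : Type*} [CStarAlgebra S] [BlockAlgebra S]
    (L₁ L₂ : FreeAlgebra ℂ ℕ+ ⊗[ℂ] S) (a₁ a₂ : ℕ+ →₀ S)
    (hL₁ : HasHamelExpansion L₁ a₁) (hL₂ : HasHamelExpansion L₂ a₂)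
    (Λ₁ Λ₂ : S) (hΛ₁ : Λ₁ ∈ domainD L₁) (hΛ₂ : Λ₂ ∈ domainD L₂) :
    IsUnit (funG L₁ Λ₁) ∧ IsUnit (funG L₂ Λ₂) ∧
    IsUnit (halfTranspose S
      (Ring.inverse (funG L₁ Λ₁) ⊗ₜ[ℂ] Ring.inverse (funG L₂ Λ₂)
        - a₁.sum fun l x => x ⊗ₜ[ℂ] a₂ l)) ∧
    funGG L₁ L₂ Λ₁ Λ₂ =
      halfTranspose S (Ring.inverse (halfTranspose S
        (Ring.inverse (funG L₁ Λ₁) ⊗ₜ[ℂ] Ring.inverse (funG L₂ Λ₂)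
          - a₁.sum fun l x => x ⊗ₜ[ℂ] a₂ l))) := by
  have := BlockAlgebra.finiteDimensional S
  -- In a Noetherian ring one-sided inverses are two-sided.
  have : IsNoetherianRing S := IsNoetherianRing.of_finite ℂ S
  have : IsNoetherianRing (S ⊗[ℂ] S) := IsNoetherianRing.of_finite ℂ (S ⊗[ℂ] S)
  have hG₁ : IsUnit (funG L₁ Λ₁) := .of_mul_eq_one_right _ (hL₁.schwingerDyson hΛ₁)
  have hG₂ : IsUnit (funG L₂ Λ₂) := .of_mul_eq_one_right _ (hL₂.schwingerDyson hΛ₂)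
  let T := BlockAlgebra.transposition (S := S)
  set G₁ := funG L₁ Λ₁
  set G₂ := funG L₂ Λ₂
  set U := halfTranspose S (funGG L₁ L₂ Λ₁ Λ₂) with hU
  set M := halfTranspose S (Ring.inverse G₁ ⊗ₜ[ℂ] Ring.inverse G₂
    - a₁.sum fun l x => x ⊗ₜ[ℂ] a₂ l) with hM
  have hTG : T.toLin (Ring.inverse G₂) * T.toLin G₂ = 1 := by
    rw [← T.map_mul, Ring.mul_inverse_cancel _ hG₂, T.map_one]
  -- The union of supports serves both sums: the statement sums over the support of `a₁`, the fixed
  -- point equation needs that of `a₂`.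
  have hsum : halfTranspose S (a₁.sum fun l x => x ⊗ₜ[ℂ] a₂ l)
      = ∑ i ∈ a₁.support ∪ a₂.support, a₁ i ⊗ₜ[ℂ] T.toLin (a₂ i) := by
    rw [Finsupp.sum_of_support_subset a₁ Finset.subset_union_left _ (by simp), map_sum]
    rfl
  have hfix : U = G₁ ⊗ₜ[ℂ] T.toLin G₂
      + ∑ i ∈ a₁.support ∪ a₂.support, (G₁ * a₁ i) ⊗ₜ[ℂ] T.toLin (a₂ i * G₂) * U := by
    have h := congrArg (halfTranspose S)
      (funGG_eq_add_sum hL₁ hL₂ hΛ₁ hΛ₂ (Finset.subset_union_right (s₁ := a₁.support)))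
    simp only [map_add, map_sum, halfTranspose_mul_mul, halfTranspose_tmul] at h
    exact h
  have hinv : Ring.inverse G₁ ⊗ₜ[ℂ] T.toLin (Ring.inverse G₂) * U
      = 1 + (∑ i ∈ a₁.support ∪ a₂.support, a₁ i ⊗ₜ[ℂ] T.toLin (a₂ i)) * U := by
    conv_lhs => rw [hfix]
    simp only [mul_add, Finset.mul_sum, Finset.sum_mul, ← mul_assoc,
      Algebra.TensorProduct.tmul_mul_tmul, T.map_mul, hTG, Ring.inverse_mul_cancel _ hG₁, one_mul,
      Algebra.TensorProduct.one_def]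
  have hMU : M * U = 1 := by
    rw [hM, map_sub, hsum, halfTranspose_tmul, sub_mul, hinv, add_sub_cancel_right]
  have hMunit : IsUnit M := .of_mul_eq_one _ hMU
  refine ⟨hG₁, hG₂, hMunit, ?_⟩
  rw [← mul_one (Ring.inverse M), (Ring.inverse_mul_eq_iff_eq_mul M 1 U hMunit).mpr hMU.symm, hU,
    halfTranspose_involutive]

end
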